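/- Let $\mathcal C$ be a semi-abelian category (pointed, with binary coproducts, Barr exact and Bourn protomodular). For an object $B$ of $\mathcal C$, let $\mathrm{Pt}_B(\mathcal C)$ be the category of points over $B$: its objects are split epimorphisms $p\colon A\to B$ with a chosen section $s\colon B\to A$, $ps=1_B$, and its morphisms commute with the projections and with the sections. Let $\mathrm{Ker}_B\colon \mathrm{Pt}_B(\mathcal C)\to\mathcal C$ send a point to the kernel of $p$. A pair of morphisms $f\colon X\to Z$, $g\colon Y\to Z$ is *jointly strongly epimorphic* if for every monomorphism $m\colon M\to N$ and all $x\colon X\to M$, $y\colon Y\to M$, $z\colon Z\to N$ with $mx=zf$ and $my=zg$ there is a $d\colon Z\to M$ with $df=x$, $dg=y$, $md=z$. The category $\mathcal C$ is *algebraically coherent* if, for every object $B$, the functor $\mathrm{Ker}_B$ preserves jointly strongly epimorphic pairs. Let $B\flat X=\ker\bigl([1,0]\colon B+X\to B\bigr)$, so that $B\flat(-)$ is the monad induced by the adjunction between $X\mapsto(B+X\to B)$ and $\mathrm{Ker}_B$; an internal action of $B$ on $X$ is an algebra structure $\xi\colon B\flat X\to X$ for this monad. A *pre-crossed $B$-module*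 is a morphism $\delta\colon X\to B$ with an internal action $\xi$ of $B$ on $X$ such that $\delta\,\xi=\chi\,(1\flat\delta)$, where $\chi\colon B\flat B\to B$ is the conjugation action, that is, the restriction of $[1,1]\colon B+B\to B$ to $B\flat B$. Pre-crossed $B$-modules, with the equivariant morphisms over $B$, form a category $\mathrm{PXMod}_B(\mathcal C)$. Then, for every object $B$ of $\mathcal C$, the category $\mathrm{PXMod}_B(\mathcal C)$ has binary coproducts, denoted $X\oplus_{PX}Y$. Moreover, $\mathcal C$ is algebraically coherent if and only if the following condition holds: (CS) for every object $B$ of $\mathcal C$ and all pre-crossed $B$-modules $X$ and $Y$, the comparison morphism $\sigma\colon X+Y\to X\oplus_{PX}Y$ in $\mathcal C$, induced by the underlying morphisms of the two coproduct injections, from the coproduct in $\mathcal C$ of the underlying objects to the underlying object of the coproduct in $\mathrm{PXMod}_B(\mathcal C)$, is a regular epimorphism in $\mathcal C$. -/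

import Mathlib

open CategoryTheory CategoryTheory.Limits

universe v u

/-- A semi-abelian category (Janelidze, Márki, Tholen): a pointed category with binary coproducts
which is Barr exact (regular, and every internal equivalence relation is effective) and Bourn
protomodular (in the pointed case: the split short five lemma holds). -/
class SemiAbelian (C : Type u) [Category.{v} C] [HasZeroMorphisms C] : Prop
    extends Regular C, HasZeroObject C where
  hasBinaryCoproducts : HasBinaryCoproducts C
  effective {R X : C} (p₁ p₂ : R ⟶ X) :
    IsEquivalenceRelation p₁ p₂ → IsEffectiveEquivalenceRelation p₁ p₂
  splitShortFive {A B A' B' : C} (p : A ⟶ B) (s : B ⟶ A) (p' : A' ⟶ B') (s' : B' ⟶ A')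
    (a : A ⟶ A') (b : B ⟶ B') (_ : s ≫ p = 𝟙 B) (_ : s' ≫ p' = 𝟙 B')
    (w : p ≫ b = a ≫ p') (_ : s ≫ a = b ≫ s') :
    IsIso b → IsIso (kernel.map p p' a b w) → IsIso a

attribute [instance] SemiAbelian.hasBinaryCoproducts

namespace SemiAbelian

noncomputable section

variable {C : Type u} [Category.{v} C]

/-- A pair of morphisms with common codomain is jointly strongly epimorphic if it is (jointly) left
orthogonal to every monomorphism. Diagonals are unique since `m` is a monomorphism. -/
def JointlyStrongEpi {X Y Z : C} (f : X ⟶ Z) (g : Y ⟶ Z) : Prop :=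
  ∀ ⦃M N : C⦄ (m : M ⟶ N) [Mono m] (x : X ⟶ M) (y : Y ⟶ M) (z : Z ⟶ N),
    x ≫ m = f ≫ z → y ≫ m = g ≫ z → ∃ d : Z ⟶ M, f ≫ d = x ∧ g ≫ d = y ∧ d ≫ m = z

/-- A point over `B`: a split epimorphism with codomain `B` and a chosen section. -/
structure Pt (B : C) where
  /-- the total object -/
  pt : C
  /-- the split epimorphism -/
  proj : pt ⟶ B
  /-- the section -/
  sec : B ⟶ pt
  sec_proj : sec ≫ proj = 𝟙 B

/-- A morphism of points over `B` commutes with the projections and with the sections. -/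
@[ext]
structure PtHom {B : C} (P Q : Pt B) where
  /-- the underlying morphism -/
  hom : P.pt ⟶ Q.pt
  hom_proj : hom ≫ Q.proj = P.proj
  sec_hom : P.sec ≫ hom = Q.sec

/-- The category of points over `B`. -/
instance Pt.category (B : C) : Category (Pt B) where
  Hom P Q := PtHom P Q
  id P := ⟨𝟙 _, by simp, by simp⟩
  comp f g := ⟨f.hom ≫ g.hom, by simp [g.hom_proj, f.hom_proj],
    by rw [← Category.assoc, f.sec_hom, g.sec_hom]⟩
  id_comp f := PtHom.ext (Category.id_comp _)
  comp_id f := PtHom.ext (Category.comp_id _)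
  assoc f g h := PtHom.ext (Category.assoc _ _ _)

@[ext]
theorem Pt.hom_ext {B : C} {P Q : Pt B} (f g : P ⟶ Q) (h : f.hom = g.hom) : f = g :=
  PtHom.ext h

@[simp]
theorem Pt.id_hom {B : C} (P : Pt B) : PtHom.hom (𝟙 P) = 𝟙 P.pt := rfl

@[simp]
theorem Pt.comp_hom {B : C} {P Q R : Pt B} (f : P ⟶ Q) (g : Q ⟶ R) :
    (f ≫ g).hom = f.hom ≫ g.hom := rfl

variable [HasZeroMorphisms C] [HasKernels C]

/-- The kernel functor from points over `B` to `C`, sending a point to the kernel of its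
projection. -/
abbrev kerFunctor (B : C) : Pt B ⥤ C where
  obj P := kernel P.proj
  map {P Q} f := kernel.lift Q.proj (kernel.ι P.proj ≫ f.hom)
    (by rw [Category.assoc, f.hom_proj, kernel.condition])
  map_id P := by rw [← cancel_mono (kernel.ι _)]; simp
  map_comp f g := by rw [← cancel_mono (kernel.ι _)]; simp

variable (C) in
/-- Algebraic coherence: every kernel functor preserves jointly strongly epimorphic pairs. -/
def AlgebraicallyCoherent : Prop :=
  ∀ (B : C) (P Q R : Pt B) (f : P ⟶ R) (g : Q ⟶ R), JointlyStrongEpi f g →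
    JointlyStrongEpi ((kerFunctor B).map f) ((kerFunctor B).map g)

variable [HasBinaryCoproducts C]

/-- The point `[1, 0] : B ⨿ X ⟶ B`, with section the first coproduct injection. -/
abbrev freePtObj (B X : C) : Pt B where
  pt := B ⨿ X
  proj := coprod.desc (𝟙 B) 0
  sec := coprod.inl
  sec_proj := coprod.inl_desc _ _

/-- The functor sending `X` to the point `[1, 0] : B ⨿ X ⟶ B`. -/
abbrev freePt (B : C) : C ⥤ Pt B where
  obj X := freePtObj B X
  map {X Y} f :=
    { hom := coprod.map (𝟙 B) f
      hom_proj := by simp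
      sec_hom := by simp }
  map_id X := Pt.hom_ext _ _ (coprod.map_id_id (X := B) (Y := X))
  map_comp {X Y Z} f g := Pt.hom_ext _ _ (by
    have h := coprod.map_map (𝟙 B) f (𝟙 B) g
    rw [Category.comp_id] at h
    exact h.symm)

/-- Morphisms of points from `B ⨿ X ⟶ B` to `P` correspond to morphisms from `X` to the kernel of
the projection of `P`. -/
def freePtEquiv (B X : C) (P : Pt B) : (freePtObj B X ⟶ P) ≃ (X ⟶ kernel P.proj) where
  toFun φ := kernel.lift P.proj (coprod.inr ≫ φ.hom) (by
    rw [Category.assoc, φ.hom_proj]; exact coprod.inr_desc _ _)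
  invFun g :=
    { hom := coprod.desc P.sec (g ≫ kernel.ι P.proj)
      hom_proj := by
        apply coprod.hom_ext <;> simp [P.sec_proj]
      sec_hom := coprod.inl_desc _ _ }
  left_inv φ := by
    apply Pt.hom_ext
    apply coprod.hom_ext
    · rw [coprod.inl_desc]; exact φ.sec_hom.symm
    · rw [coprod.inr_desc, kernel.lift_ι]
  right_inv g := by
    rw [← cancel_mono (kernel.ι _), kernel.lift_ι, coprod.inr_desc]

/-- The functor `X ↦ (B ⨿ X ⟶ B)` is left adjoint to the kernel functor. -/
def freePtAdjunction (B : C) : freePt B ⊣ kerFunctor B :=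
  Adjunction.mkOfHomEquiv
    { homEquiv X P := freePtEquiv B X P
      homEquiv_naturality_left_symm {X' X P} f g := by
        apply Pt.hom_ext
        simp [freePtEquiv]
      homEquiv_naturality_right {X P Q} f g := by
        apply (cancel_mono (kernel.ι Q.proj)).1
        simp [freePtEquiv] }

/-- The monad `B ♭ (-)` on `C` induced by the adjunction between `X ↦ (B ⨿ X ⟶ B)` and the kernel
functor: `B ♭ X` is the kernel of `[1, 0] : B ⨿ X ⟶ B`. Internal actions of `B` are its
algebras. -/
def flat (B : C) : Monad C := (freePtAdjunction B).toMonad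

/-- The conjugation action `B ♭ B ⟶ B` of `B` on itself: the restriction of the codiagonal
`[1, 1] : B ⨿ B ⟶ B` to the kernel of `[1, 0]`. -/
def conj (B : C) : (flat B).obj B ⟶ B :=
  kernel.ι (coprod.desc (𝟙 B) (0 : B ⟶ B)) ≫ coprod.desc (𝟙 B) (𝟙 B)

/-- An internal pre-crossed module with codomain `B`: an object with an internal `B`-action and an
arrow `δ` to `B` which is equivariant with respect to the conjugation action of `B` on itself. -/
structure PXMod (B : C) where
  /-- the domain, together with the internal action of `B` on it -/
  act : (flat B).Algebra
  /-- the boundary morphism -/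
  δ : act.A ⟶ B
  equivariant : act.a ≫ δ = (flat B).map δ ≫ conj B

/-- A morphism of pre-crossed `B`-modules: an equivariant morphism over `B`. -/
@[ext]
structure PXModHom {B : C} (X Y : PXMod B) where
  /-- the underlying equivariant morphism -/
  hom : X.act ⟶ Y.act
  hom_δ : hom.f ≫ Y.δ = X.δ

/-- The category of pre-crossed `B`-modules. -/
instance PXMod.category (B : C) : Category (PXMod B) where
  Hom X Y := PXModHom X Y
  id X := ⟨𝟙 _, by simp⟩
  comp f g := ⟨f.hom ≫ g.hom, by simp [g.hom_δ, f.hom_δ]⟩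
  id_comp f := PXModHom.ext (Category.id_comp _)
  comp_id f := PXModHom.ext (Category.comp_id _)
  assoc f g h := PXModHom.ext (Category.assoc _ _ _)

variable (C) in
/-- Condition (CS): for all pre-crossed `B`-modules `X`, `Y` and every coproduct `c` of `X` and `Y`
in the category of pre-crossed `B`-modules, the comparison in `C` from the coproduct of the
underlying objects to the underlying object of `c`, induced by the underlying morphisms of the two
injections, is a regular epimorphism. -/
def ConditionCS : Prop :=
  ∀ (B : C) (X Y : PXMod B) (c : BinaryCofan X Y), Nonempty (IsColimit c) →
    IsRegularEpi (coprod.desc (PXModHom.hom c.inl).f (PXModHom.hom c.inr).f :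
      X.act.A ⨿ Y.act.A ⟶ c.pt.act.A)

end

end SemiAbelian

/-! ### Protomodularity and the Mal'tsev property -/

namespace SemiAbelian

noncomputable section

variable {C : Type u} [Category.{v} C] [HasZeroMorphisms C] [SemiAbelian C]

attribute [local simp] pullback.lift_fst pullback.lift_fst_assoc pullback.lift_snd
  pullback.lift_snd_assoc prod.lift_fst prod.lift_fst_assoc prod.lift_snd prod.lift_snd_assoc

/-! Two translations reduce the theorem to a statement about points.

Split short five and exactness give the Mal'tsev property, so the image of a reflexive pair is an
effective equivalence relation. Hence reflexive coequalizers of points exist, and `kerFunctor B`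
preserves them because it preserves kernel pairs and regular epimorphisms. It also reflects
isomorphisms, so it is monadic: points over `B` are internal actions of `B`.

A pre-crossed module is an action with an equivariant map to `conjAlgebra B`, so `PXMod B` is a
slice of the category of actions, and its coproducts are those of the underlying actions. They exist
because points have coproducts.

A pair is jointly strongly epimorphic iff its copairing is a regular epimorphism. So (CS) says that
the injections of a coproduct of pre-crossed modules are jointly strongly epimorphic in `C`.
Coherence gives this, coproduct injections of points being jointly strongly epimorphic. Conversely,
give all actions zero boundary: for a jointly strongly epimorphic pair of points, the map out of the
coproduct is a regular epimorphism whose kernel part is again one, and precomposing with the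
comparison σ yields the copairing of the kernel maps. -/

/-- The kernel and the section of a point are jointly extremally epimorphic. -/
theorem isIso_of_kernel_of_section {A B M : C} (p : A ⟶ B) (s : B ⟶ A) (hs : s ≫ p = 𝟙 B)
    (m : M ⟶ A) [Mono m] (k : kernel p ⟶ M) (hk : k ≫ m = kernel.ι p)
    (t : B ⟶ M) (ht : t ≫ m = s) : IsIso m := by
  refine splitShortFive (m ≫ p) t p s m (𝟙 B) (by rw [reassoc_of% ht, hs]) hs (by simp)
    (by simp [ht]) inferInstance
    ⟨kernel.lift _ k (by rw [reassoc_of% hk, kernel.condition]), ?_, ?_⟩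
  · simp [← cancel_mono (kernel.ι _), ← cancel_mono m, hk]
  · simp [← cancel_mono (kernel.ι _), hk]

/-- The section of a point and any pullback of its projection are jointly extremally epimorphic. -/
theorem isIso_of_isPullback_of_section {A B E T M : C} {p : A ⟶ B} {s : B ⟶ A}
    (hs : s ≫ p = 𝟙 B) {a : T ⟶ A} {e : T ⟶ E} {v : E ⟶ B} (h : IsPullback a e p v)
    (m : M ⟶ A) [Mono m] (k : T ⟶ M) (hk : k ≫ m = a) (t : B ⟶ M) (ht : t ≫ m = s) :
    IsIso m :=
  isIso_of_kernel_of_section p s hs m (h.lift (kernel.ι p) 0 (by simp) ≫ k) (by simp [hk]) t ht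

/-- The fibres of the fibration of points are unital. -/
theorem isIso_of_factors_through_pullback {A B D M : C} {p : A ⟶ B} {s : B ⟶ A} {q : D ⟶ B}
    {t : B ⟶ D} (hs : s ≫ p = 𝟙 B) (ht : t ≫ q = 𝟙 B) (m : M ⟶ pullback p q) [Mono m]
    (x : A ⟶ M) (hx : x ≫ m = pullback.lift (𝟙 A) (p ≫ t) (by simp [ht]))
    (y : D ⟶ M) (hy : y ≫ m = pullback.lift (q ≫ s) (𝟙 D) (by simp [hs])) : IsIso m := by
  -- `A` is the pullback along `t` of the projection to `D`, which is split by `(q ≫ s, 𝟙)`.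
  refine isIso_of_isPullback_of_section (p := pullback.snd p q) (v := t) (e := p)
    (pullback.lift_snd _ _ _) ⟨⟨by simp⟩, ⟨PullbackCone.IsLimit.mk _
      (fun c => c.fst ≫ pullback.fst p q) ?_ ?_ ?_⟩⟩ m x hx y hy
  · intro c
    have h := c.condition =≫ q
    simp only [Category.assoc, ht, Category.comp_id, ← pullback.condition] at h
    apply pullback.hom_ext
    · simp
    · simp [reassoc_of% h, c.condition]
  · intro c
    have h := c.condition =≫ q
    simpa only [Category.assoc, ht, Category.comp_id, ← pullback.condition] using h
  · intro c l h₁ _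
    simp [← h₁]

/-- Every internal relation is difunctional. -/
theorem exists_difunctional {R X Y : C} {p₁ : R ⟶ X} {p₂ : R ⟶ Y} (hR : JointlyMono₂ p₁ p₂)
    {W : C} (a b c : W ⟶ R) (hab : a ≫ p₂ = b ≫ p₂) (hbc : b ≫ p₁ = c ≫ p₁) :
    ∃ d : W ⟶ R, d ≫ p₁ = a ≫ p₁ ∧ d ≫ p₂ = c ≫ p₂ := by
  let T := pullback (pullback.snd p₂ p₂) (pullback.fst p₁ p₁)
  let u : T ⟶ X := pullback.fst _ _ ≫ pullback.fst _ _ ≫ p₁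
  let w : T ⟶ Y := pullback.snd _ _ ≫ pullback.snd _ _ ≫ p₂
  have : Mono (prod.lift p₁ p₂) := ⟨fun f g h => hR.right_cancellation f g
    (by simpa using h =≫ prod.fst) (by simpa using h =≫ prod.snd)⟩
  -- In elements, `T` consists of triples `(a, b, c)` as in the statement, and `m` is the subobject
  -- where `(a ≫ p₁, c ≫ p₂)` lies in `R`. It contains all `(a, b, b)`, witnessed by `a`, and all
  -- `(b, b, c)`, witnessed by `c`; by unitality it is everything.
  let m : pullback (prod.lift u w) (prod.lift p₁ p₂) ⟶ T := pullback.fst _ _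
  have : IsIso m := by
    refine isIso_of_factors_through_pullback
      (s := pullback.lift (𝟙 R) (𝟙 R) rfl) (t := pullback.lift (𝟙 R) (𝟙 R) rfl)
      (by simp) (by simp) m
      (pullback.lift (pullback.lift (𝟙 _) (pullback.snd _ _ ≫ pullback.lift (𝟙 R) (𝟙 R) rfl)
        (by simp)) (pullback.fst _ _) ?_) (pullback.lift_fst _ _ _)
      (pullback.lift (pullback.lift (pullback.fst _ _ ≫ pullback.lift (𝟙 R) (𝟙 R) rfl) (𝟙 _)
        (by simp)) (pullback.snd _ _) ?_) (pullback.lift_fst _ _ _)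
    · ext <;> simp [u, w, T, pullback.condition]
    · ext <;> simp [u, w, T, pullback.condition]
  let e : W ⟶ T := pullback.lift (pullback.lift a b hab) (pullback.lift b c hbc) (by simp)
  have h : inv m ≫ pullback.snd _ _ ≫ prod.lift p₁ p₂ = prod.lift u w := by
    rw [← pullback.condition, IsIso.inv_hom_id_assoc]
  refine ⟨e ≫ inv m ≫ pullback.snd _ _, ?_, ?_⟩
  · have := e ≫= h =≫ prod.fst
    simpa [u, e, T] using this
  · have := e ≫= h =≫ prod.snd
    simpa [w, e, T] using this

/-- The Mal'tsev property: a reflexive relation is an equivalence relation. -/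
theorem isEquivalenceRelation_of_reflexive {R X : C} {p₁ p₂ : R ⟶ X} (hR : JointlyMono₂ p₁ p₂)
    (r : X ⟶ R) (h₁ : r ≫ p₁ = 𝟙 X) (h₂ : r ≫ p₂ = 𝟙 X) : IsEquivalenceRelation p₁ p₂ := by
  -- From `(y, y)`, `(x, y)`, `(x, x)` to `(y, x)`.
  obtain ⟨s, hs₁, hs₂⟩ := exists_difunctional hR (p₂ ≫ r) (𝟙 R) (p₁ ≫ r) (by simp [h₂])
    (by simp [h₁])
  -- From `(x, y)`, `(y, y)`, `(y, z)` to `(x, z)`.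
  obtain ⟨t, ht₁, ht₂⟩ := exists_difunctional hR (pullback.fst p₂ p₁)
    (pullback.fst p₂ p₁ ≫ p₂ ≫ r) (pullback.snd p₂ p₁) (by simp [h₂])
    (by simp [h₁, pullback.condition])
  exact ⟨⟨{ toReflexiveRelation := ⟨hR, r, h₁, h₂⟩
            s := s
            symmetry₁ := by simpa [h₁] using hs₁
            symmetry₂ := by simpa [h₂] using hs₂
            c := _
            isLimit := pullbackIsPullback p₂ p₁
            t := t
            transitivity₁ := ht₁
            transitivity₂ := ht₂ }⟩⟩

end

end SemiAbelian

/-! ### Reflexive coequalizers of points and monadicity of the kernel functor -/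

namespace SemiAbelian

noncomputable section

variable {C : Type u} [Category.{v} C]

/-- A regular epimorphism is the coequalizer of its kernel pair precomposed with an epimorphism. -/
theorem nonempty_isColimit_cofork_of_isKernelPair {A R X Q : C} {f g : A ⟶ X} {e : A ⟶ R} [Epi e]
    {r₁ r₂ : R ⟶ X} (h₁ : e ≫ r₁ = f) (h₂ : e ≫ r₂ = g) {q : X ⟶ Q} [IsRegularEpi q]
    (hq : IsKernelPair q r₁ r₂) (w : f ≫ q = g ≫ q) :
    Nonempty (IsColimit (Cofork.ofπ q w)) := by
  have hw (s : Cofork f g) : r₁ ≫ s.π = r₂ ≫ s.π := by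
    rw [← cancel_epi e, reassoc_of% h₁, reassoc_of% h₂, s.condition]
  exact ⟨Cofork.IsColimit.mk _ (fun s => hq.toCoequalizer'.desc (Cofork.ofπ s.π (hw s)))
    (fun s => hq.toCoequalizer'.fac (Cofork.ofπ s.π (hw s)) WalkingParallelPair.one)
    (fun s m hm => Cofork.IsColimit.hom_ext hq.toCoequalizer' (hm.trans
      (hq.toCoequalizer'.fac (Cofork.ofπ s.π (hw s)) WalkingParallelPair.one).symm))⟩

variable {B : C}

/-- A cofork of points is a coequalizer if it is so in the base category. -/
theorem nonempty_isColimit_cofork_pt {P X Q : Pt B} {f g : P ⟶ X} {q : X ⟶ Q} (w : f ≫ q = g ≫ q)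
    (w' : f.hom ≫ q.hom = g.hom ≫ q.hom) (h : IsColimit (Cofork.ofπ q.hom w')) :
    Nonempty (IsColimit (Cofork.ofπ q w)) := by
  have hs (s : Cofork f g) : f.hom ≫ s.π.hom = g.hom ≫ s.π.hom :=
    congrArg PtHom.hom s.condition
  have hq {Y : C} {a b : Q.pt ⟶ Y} (hab : q.hom ≫ a = q.hom ≫ b) : a = b :=
    Cofork.IsColimit.hom_ext h hab
  have hd (s : Cofork f g) : q.hom ≫ h.desc (Cofork.ofπ s.π.hom (hs s)) = s.π.hom :=
    h.fac _ WalkingParallelPair.one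
  refine ⟨Cofork.IsColimit.mk _ (fun s => ⟨h.desc (Cofork.ofπ s.π.hom (hs s)), hq ?_, ?_⟩)
    (fun s => Pt.hom_ext _ _ (hd s))
    (fun s m hm => Pt.hom_ext _ _ (hq ((congrArg PtHom.hom hm).trans (hd s).symm)))⟩
  · rw [reassoc_of% hd s, s.π.hom_proj]
    exact q.hom_proj.symm
  · change Q.sec ≫ _ = _
    rw [← q.sec_hom, Category.assoc, hd, s.π.sec_hom]

theorem Pt.isIso_of_isIso_hom {P Q : Pt B} (f : P ⟶ Q) [IsIso f.hom] : IsIso f :=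
  ⟨⟨⟨inv f.hom, by rw [IsIso.inv_comp_eq, f.hom_proj], by rw [IsIso.comp_inv_eq, f.sec_hom]⟩,
    Pt.hom_ext _ _ (IsIso.hom_inv_id f.hom), Pt.hom_ext _ _ (IsIso.inv_hom_id f.hom)⟩⟩

variable [HasZeroMorphisms C] [SemiAbelian C]

/-- The image of a reflexive pair is the kernel pair of a regular epimorphism. -/
theorem exists_isKernelPair_of_isReflexivePair {A X : C} (f g : A ⟶ X) [IsReflexivePair f g] :
    ∃ (R Q : C) (e : A ⟶ R) (r₁ r₂ : R ⟶ X) (q : X ⟶ Q), IsRegularEpi e ∧ e ≫ r₁ = f ∧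
      e ≫ r₂ = g ∧ IsKernelPair q r₁ r₂ ∧ IsRegularEpi q := by
  let F := Regular.strongEpiMonoFactorisation (prod.lift f g)
  have h₁ : F.e ≫ F.m ≫ prod.fst = f := by rw [F.fac_assoc, prod.lift_fst]
  have h₂ : F.e ≫ F.m ≫ prod.snd = g := by rw [F.fac_assoc, prod.lift_snd]
  have hR : IsEquivalenceRelation (F.m ≫ prod.fst) (F.m ≫ prod.snd) := by
    refine isEquivalenceRelation_of_reflexive ⟨fun Y a b ha hb => ?_⟩
      (commonSection f g ≫ F.e) (by simp [h₁]) (by simp [h₂])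
    rw [← cancel_mono F.m]
    ext <;> simpa
  obtain ⟨⟨E⟩⟩ := effective _ _ hR
  exact ⟨F.I, E.B, F.e, _, _, E.π, inferInstanceAs (IsRegularEpi
    (Regular.strongEpiMonoFactorisation (prod.lift f g)).e), h₁, h₂, E.isKernelPair, inferInstance⟩

theorem isRegularEpi_of_isPullback {P X Y Z : C} {fst : P ⟶ X} {snd : P ⟶ Y} {f : X ⟶ Z}
    {g : Y ⟶ Z} (h : IsPullback fst snd f g) [IsRegularEpi g] : IsRegularEpi fst :=
  Regular.regularEpiIsStableUnderBaseChange.of_isPullback h.flip ‹_›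

@[simp]
theorem kerFunctor_map_ι {P Q : Pt B} (f : P ⟶ Q) :
    (kerFunctor B).map f ≫ kernel.ι Q.proj = kernel.ι P.proj ≫ f.hom :=
  kernel.lift_ι _ _ _

/-- The kernel of a morphism of points is a pullback of it. -/
theorem isPullback_kerFunctor_map {P Q : Pt B} (f : P ⟶ Q) :
    IsPullback ((kerFunctor B).map f) (kernel.ι P.proj) (kernel.ι Q.proj) f.hom := by
  refine ⟨⟨by simp⟩, ⟨PullbackCone.IsLimit.mk _
    (fun s => kernel.lift P.proj s.snd ?_) ?_ ?_ ?_⟩⟩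
  · rw [← f.hom_proj, ← reassoc_of% s.condition, kernel.condition, comp_zero]
  · intro s
    rw [← cancel_mono (kernel.ι Q.proj), Category.assoc, kerFunctor_map_ι, kernel.lift_ι_assoc,
      s.condition]
  · intro s
    exact kernel.lift_ι _ _ _
  · intro s m _ h
    rw [← cancel_mono (kernel.ι P.proj), h, kernel.lift_ι]

theorem isRegularEpi_kerFunctor_map {P Q : Pt B} (f : P ⟶ Q) [IsRegularEpi f.hom] :
    IsRegularEpi ((kerFunctor B).map f) :=
  isRegularEpi_of_isPullback (isPullback_kerFunctor_map f)

/-- The kernel functor preserves kernel pairs. -/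
theorem isKernelPair_kerFunctor_map {R X Q : Pt B} {r₁ r₂ : R ⟶ X} {q : X ⟶ Q}
    (h : IsKernelPair q.hom r₁.hom r₂.hom) :
    IsKernelPair ((kerFunctor B).map q) ((kerFunctor B).map r₁) ((kerFunctor B).map r₂) := by
  have w : r₁ ≫ q = r₂ ≫ q := Pt.hom_ext _ _ h.w
  have hc (s : PullbackCone ((kerFunctor B).map q) ((kerFunctor B).map q)) :
      (s.fst ≫ kernel.ι X.proj) ≫ q.hom = (s.snd ≫ kernel.ι X.proj) ≫ q.hom := by
    have := s.condition =≫ kernel.ι Q.proj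
    simpa only [Category.assoc, kernel.lift_ι] using this
  refine ⟨⟨by rw [← Functor.map_comp, w, Functor.map_comp]⟩, ⟨PullbackCone.IsLimit.mk _
    (fun s => kernel.lift R.proj (h.lift _ _ (hc s)) ?_) ?_ ?_ ?_⟩⟩
  · rw [← r₁.hom_proj, IsKernelPair.lift_fst_assoc, Category.assoc, kernel.condition, comp_zero]
  · intro s
    rw [← cancel_mono (kernel.ι X.proj), Category.assoc, kerFunctor_map_ι, kernel.lift_ι_assoc,
      IsKernelPair.lift_fst]
  · intro s
    rw [← cancel_mono (kernel.ι X.proj), Category.assoc, kerFunctor_map_ι, kernel.lift_ι_assoc,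
      IsKernelPair.lift_snd]
  · intro s m h₁ h₂
    rw [← cancel_mono (kernel.ι R.proj), kernel.lift_ι]
    apply h.hom_ext
    · rw [IsKernelPair.lift_fst, Category.assoc, ← kerFunctor_map_ι, reassoc_of% h₁]
    · rw [IsKernelPair.lift_snd, Category.assoc, ← kerFunctor_map_ι, reassoc_of% h₂]

/-- A reflexive pair of points has a coequalizer that is preserved by the kernel functor. -/
theorem exists_coequalizer_pt {P X : Pt B} (f g : P ⟶ X) [IsReflexivePair f g] :
    ∃ (Q : Pt B) (q : X ⟶ Q) (w : f ≫ q = g ≫ q), Nonempty (IsColimit (Cofork.ofπ q w)) ∧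
      Nonempty (IsColimit (Cofork.ofπ ((kerFunctor B).map q)
        (f := (kerFunctor B).map f) (g := (kerFunctor B).map g)
        (by rw [← Functor.map_comp, w, Functor.map_comp]))) := by
  have : IsReflexivePair f.hom g.hom := IsReflexivePair.mk' (commonSection f g).hom
    (congrArg PtHom.hom (section_comp_left f g)) (congrArg PtHom.hom (section_comp_right f g))
  obtain ⟨R, Q, e, r₁, r₂, q, he, h₁, h₂, hk, hq⟩ :=
    exists_isKernelPair_of_isReflexivePair f.hom g.hom
  have hr : r₁ ≫ X.proj = r₂ ≫ X.proj := by
    rw [← cancel_epi e, reassoc_of% h₁, reassoc_of% h₂, f.hom_proj, g.hom_proj]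
  have w' : f.hom ≫ q = g.hom ≫ q := by rw [← h₁, ← h₂, Category.assoc, Category.assoc, hk.w]
  obtain ⟨hc⟩ := nonempty_isColimit_cofork_of_isKernelPair h₁ h₂ hk w'
  -- The coequalizer taken in `C`, and the image `R`, are given the structure of points, so that the
  -- kernel functor applies to the whole diagram.
  let p : Q ⟶ B := hc.desc (Cofork.ofπ X.proj (by rw [f.hom_proj, g.hom_proj]))
  have hp : q ≫ p = X.proj := hc.fac _ WalkingParallelPair.one
  let Q' : Pt B := ⟨Q, p, X.sec ≫ q, by rw [Category.assoc, hp, X.sec_proj]⟩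
  let R' : Pt B := ⟨R, r₁ ≫ X.proj, P.sec ≫ e, by
    rw [Category.assoc, reassoc_of% h₁, f.hom_proj, P.sec_proj]⟩
  let q' : X ⟶ Q' := ⟨q, hp, rfl⟩
  let e' : P ⟶ R' := ⟨e, by rw [reassoc_of% h₁, f.hom_proj], rfl⟩
  let r₁' : R' ⟶ X := ⟨r₁, rfl, by rw [Category.assoc, h₁, f.sec_hom]⟩
  let r₂' : R' ⟶ X := ⟨r₂, hr.symm, by rw [Category.assoc, h₂, g.sec_hom]⟩
  have h₁' : e' ≫ r₁' = f := Pt.hom_ext _ _ h₁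
  have h₂' : e' ≫ r₂' = g := Pt.hom_ext _ _ h₂
  have w : f ≫ q' = g ≫ q' := Pt.hom_ext _ _ w'
  have : IsRegularEpi q'.hom := hq
  have : IsRegularEpi e'.hom := he
  have := isRegularEpi_kerFunctor_map q'
  have := isRegularEpi_kerFunctor_map e'
  exact ⟨Q', q', w, nonempty_isColimit_cofork_pt w w' hc,
    nonempty_isColimit_cofork_of_isKernelPair (e := (kerFunctor B).map e')
      (by rw [← Functor.map_comp, h₁']) (by rw [← Functor.map_comp, h₂'])
      (isKernelPair_kerFunctor_map (r₁ := r₁') (r₂ := r₂') hk) _⟩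

instance : HasReflexiveCoequalizers (Pt B) where
  has_coeq _ _ f g _ := by
    obtain ⟨Q, q, w, ⟨h⟩, -⟩ := exists_coequalizer_pt f g
    exact ⟨⟨_, h⟩⟩

instance : Monad.PreservesColimitOfIsReflexivePair (kerFunctor B) where
  out _ _ f g _ := by
    obtain ⟨Q, q, w, ⟨h⟩, ⟨h'⟩⟩ := exists_coequalizer_pt f g
    exact preservesColimit_of_preserves_colimit_cocone h
      ((isColimitMapCoconeCoforkEquiv (kerFunctor B) w).symm h')

/-- This is the split short five lemma over the identity of `B`. -/
instance : (kerFunctor B).ReflectsIsomorphisms where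
  reflects {P Q} f _ := by
    have w : P.proj ≫ 𝟙 B = f.hom ≫ Q.proj := by rw [Category.comp_id, f.hom_proj]
    have hk : kernel.map P.proj Q.proj f.hom (𝟙 B) w = (kerFunctor B).map f := by
      rw [← cancel_mono (kernel.ι Q.proj), kernel.lift_ι]
    have : IsIso f.hom := splitShortFive P.proj P.sec Q.proj Q.sec f.hom (𝟙 B) P.sec_proj
      Q.sec_proj w (by rw [f.sec_hom, Category.id_comp]) inferInstance (hk ▸ ‹_›)
    exact Pt.isIso_of_isIso_hom f

/-- The internal action of `B` on the kernel of a point over `B`. -/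
def toAction (B : C) : Pt B ⥤ (flat B).Algebra :=
  Monad.comparison (freePtAdjunction B)

/-- Points over `B` are equivalent to internal actions of `B`. -/
instance (B : C) : (toAction B).IsEquivalence :=
  (Monad.monadicOfHasPreservesReflexiveCoequalizersOfReflectsIsomorphisms
    (freePtAdjunction B)).eqv

end

end SemiAbelian

/-! ### Coproducts of points, actions and pre-crossed modules -/

namespace SemiAbelian

noncomputable section

variable {C : Type u} [Category.{v} C] [HasZeroMorphisms C] [SemiAbelian C] {B : C}

attribute [local simp] coprod.inl_desc coprod.inl_desc_assoc coprod.inr_desc coprod.inr_desc_assoc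

instance : HasReflexiveCoequalizers C where
  has_coeq _ _ f g _ := by
    obtain ⟨R, Q, e, r₁, r₂, q, he, h₁, h₂, hk, hq⟩ := exists_isKernelPair_of_isReflexivePair f g
    obtain ⟨h⟩ := nonempty_isColimit_cofork_of_isKernelPair h₁ h₂ hk
      (by rw [← h₁, ← h₂, Category.assoc, Category.assoc, hk.w])
    exact ⟨⟨_, h⟩⟩

/-- The coproduct of points is the pushout of their sections, that is, the coequalizer of a
reflexive pair. -/
instance : HasBinaryCoproducts (Pt B) := by
  refine @hasBinaryCoproducts_of_hasColimit_pair _ _ fun {P Q} => ?_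
  -- The summand `B` identifies the two sections; on `P.pt` and `Q.pt` both maps are the injections,
  -- which only serves to provide a common section.
  let f : (P.pt ⨿ B) ⨿ Q.pt ⟶ P.pt ⨿ Q.pt :=
    coprod.desc (coprod.desc coprod.inl (P.sec ≫ coprod.inl)) coprod.inr
  let g : (P.pt ⨿ B) ⨿ Q.pt ⟶ P.pt ⨿ Q.pt :=
    coprod.desc (coprod.desc coprod.inl (Q.sec ≫ coprod.inr)) coprod.inr
  have : IsReflexivePair f g :=
    IsReflexivePair.mk' (coprod.desc (coprod.inl ≫ coprod.inl) coprod.inr)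
      (by ext <;> simp [f]) (by ext <;> simp [g])
  have hfg {Z : C} {a : P.pt ⟶ Z} {b : Q.pt ⟶ Z} (h : P.sec ≫ a = Q.sec ≫ b) :
      f ≫ coprod.desc a b = g ≫ coprod.desc a b := by
    ext <;> simp [f, g, h]
  have hs : P.sec ≫ coprod.inl ≫ coequalizer.π f g = Q.sec ≫ coprod.inr ≫ coequalizer.π f g := by
    have := (coprod.inr ≫ coprod.inl) ≫= coequalizer.condition f g
    simpa [f, g] using this
  let E : Pt B := ⟨coequalizer f g, coequalizer.desc (coprod.desc P.proj Q.proj)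
    (hfg (by rw [P.sec_proj, Q.sec_proj])), P.sec ≫ coprod.inl ≫ coequalizer.π f g,
    by simp [P.sec_proj]⟩
  let i : P ⟶ E := ⟨coprod.inl ≫ coequalizer.π f g, by simp [E], rfl⟩
  let j : Q ⟶ E := ⟨coprod.inr ≫ coequalizer.π f g, by simp [E], hs.symm⟩
  let d {T : Pt B} (a : P ⟶ T) (b : Q ⟶ T) : E ⟶ T :=
    ⟨coequalizer.desc (coprod.desc a.hom b.hom) (hfg (by rw [a.sec_hom, b.sec_hom])),
      coequalizer.hom_ext (by simp [E, a.hom_proj, b.hom_proj]), by simp [E, a.sec_hom]⟩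
  refine ⟨⟨BinaryCofan.mk i j, BinaryCofan.IsColimit.mk _ d
    (fun a b => Pt.hom_ext (i ≫ d a b) a (by simp [i, d]))
    (fun a b => Pt.hom_ext (j ≫ d a b) b (by simp [j, d])) fun {T} a b m ha hb => ?_⟩⟩
  have ha' : (coprod.inl ≫ coequalizer.π f g) ≫ m.hom = a.hom := congrArg PtHom.hom ha
  have hb' : (coprod.inr ≫ coequalizer.π f g) ≫ m.hom = b.hom := congrArg PtHom.hom hb
  refine Pt.hom_ext m (d a b) (coequalizer.hom_ext (coprod.hom_ext ?_ ?_))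
  · exact (Category.assoc _ _ _).symm.trans (ha'.trans (by simp [d]))
  · exact (Category.assoc _ _ _).symm.trans (hb'.trans (by simp [d]))

theorem hasBinaryCoproducts_algebra (B : C) : HasBinaryCoproducts (flat B).Algebra :=
  Adjunction.hasColimitsOfShape_of_equivalence (toAction B).inv

/-- The inclusion of `B ♭ X` in `B ⨿ X`. -/
def flatι (B X : C) : (flat B).obj X ⟶ B ⨿ X :=
  kernel.ι (coprod.desc (𝟙 B) (0 : X ⟶ B))

theorem conj_eq (B : C) : conj B = flatι B B ≫ coprod.desc (𝟙 B) (𝟙 B) := rfl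

theorem flatι_desc (B X : C) : flatι B X ≫ coprod.desc (𝟙 B) 0 = 0 :=
  kernel.condition _

theorem flat_η_ι (B X : C) : (flat B).η.app X ≫ flatι B X = coprod.inr := by
  have h : (flat B).η.app X = freePtEquiv B X _ (𝟙 (freePtObj B X)) := by
    simp [flat, freePtAdjunction]
    rfl
  rw [h]
  exact (kernel.lift_ι _ _ _).trans (Category.comp_id _)

theorem flat_map_ι (B : C) {X Y : C} (f : X ⟶ Y) :
    (flat B).map f ≫ flatι B Y = flatι B X ≫ coprod.map (𝟙 B) f :=
  kernel.lift_ι _ _ _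

theorem flat_μ_ι (B X : C) :
    (flat B).μ.app X ≫ flatι B X =
      flatι B ((flat B).obj X) ≫ coprod.desc coprod.inl (flatι B X) := by
  -- The multiplication is the kernel functor applied to the counit at the free point.
  have h : (flat B).μ.app X = (kerFunctor B).map
      ((freePtEquiv B _ (freePtObj B X)).symm (𝟙 (kernel (freePtObj B X).proj))) := by
    simp [flat, freePtAdjunction]
    rfl
  rw [h]
  refine (kernel.lift_ι _ _ _).trans ?_
  refine congrArg (kernel.ι _ ≫ ·) ?_
  exact coprod.hom_ext ((coprod.inl_desc _ _).trans (coprod.inl_desc _ _).symm)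
    ((coprod.inr_desc _ _).trans ((Category.id_comp _).trans (coprod.inr_desc _ _).symm))

/-- The conjugation action of `B` on itself, as an algebra. -/
def conjAlgebra (B : C) : (flat B).Algebra where
  A := B
  a := conj B
  unit := ((Category.assoc _ _ _).symm.trans (flat_η_ι B B =≫ _)).trans (coprod.inr_desc _ _)
  assoc := by
    rw [conj_eq, reassoc_of% flat_μ_ι B B, reassoc_of% flat_map_ι B (flatι B B ≫ _), coprod.desc_comp, coprod.map_desc,
      coprod.inl_desc, Category.comp_id, Category.comp_id]

/-- The boundary of a pre-crossed module, as an equivariant morphism. -/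
def PXMod.boundary (X : PXMod B) : X.act ⟶ conjAlgebra B where
  f := X.δ
  h := X.equivariant.symm

/-- The pre-crossed module given by an equivariant morphism to `B`. -/
def PXMod.ofHom {A : (flat B).Algebra} (d : A ⟶ conjAlgebra B) : PXMod B where
  act := A
  δ := d.f
  equivariant := d.h.symm

/-- The pre-crossed module with zero boundary on an internal action. -/
def PXMod.zero (A : (flat B).Algebra) : PXMod B where
  act := A
  δ := 0
  equivariant := by
    rw [comp_zero, conj_eq, reassoc_of% flat_map_ι B (0 : A.A ⟶ B), coprod.map_desc, Category.id_comp, zero_comp,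
      flatι_desc]

/-- The underlying action of a coproduct of pre-crossed modules is a coproduct of actions. -/
theorem exists_isColimit_binaryCofan_pxmod (X Y : PXMod B) :
    ∃ c : BinaryCofan X Y, Nonempty (IsColimit c) ∧
      Nonempty (IsColimit (BinaryCofan.mk c.inl.hom c.inr.hom)) := by
  have := hasBinaryCoproducts_algebra B
  -- As in any slice category: the coproduct of the actions, with the copairing of the boundaries as
  -- its boundary.
  let c : BinaryCofan X Y := BinaryCofan.mk (P := PXMod.ofHom (coprod.desc X.boundary Y.boundary))
    ⟨coprod.inl, congrArg Monad.Algebra.Hom.f (coprod.inl_desc X.boundary Y.boundary)⟩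
    ⟨coprod.inr, congrArg Monad.Algebra.Hom.f (coprod.inr_desc X.boundary Y.boundary)⟩
  refine ⟨c, ⟨BinaryCofan.IsColimit.mk _ (fun {T} a b => ⟨coprod.desc a.hom b.hom, ?_⟩)
    ?_ ?_ ?_⟩, ⟨coprodIsCoprod _ _⟩⟩
  · refine congrArg Monad.Algebra.Hom.f (?_ : coprod.desc a.hom b.hom ≫ T.boundary =
      coprod.desc X.boundary Y.boundary)
    ext1
    · rw [coprod.inl_desc_assoc, coprod.inl_desc]
      exact Monad.Algebra.Hom.ext a.hom_δ
    · rw [coprod.inr_desc_assoc, coprod.inr_desc]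
      exact Monad.Algebra.Hom.ext b.hom_δ
  · intro T a b
    exact PXModHom.ext (coprod.inl_desc _ _)
  · intro T a b
    exact PXModHom.ext (coprod.inr_desc _ _)
  · intro T a b m ha hb
    refine PXModHom.ext (coprod.hom_ext ?_ ?_)
    · exact (congrArg PXModHom.hom ha).trans (coprod.inl_desc _ _).symm
    · exact (congrArg PXModHom.hom hb).trans (coprod.inr_desc _ _).symm

instance : HasBinaryCoproducts (PXMod B) := by
  refine @hasBinaryCoproducts_of_hasColimit_pair _ _ fun {X Y} => ?_
  obtain ⟨c, ⟨h⟩, -⟩ := exists_isColimit_binaryCofan_pxmod X Y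
  exact ⟨⟨c, h⟩⟩

/-- `ConditionCS` concerns an arbitrary coproduct, so the result for the constructed one is
transported along the unique isomorphism. -/
theorem nonempty_isColimit_binaryCofan_act {X Y : PXMod B} {c : BinaryCofan X Y}
    (hc : IsColimit c) : Nonempty (IsColimit (BinaryCofan.mk c.inl.hom c.inr.hom)) := by
  obtain ⟨c', ⟨h⟩, ⟨h'⟩⟩ := exists_isColimit_binaryCofan_pxmod X Y
  let e := h.uniqueUpToIso hc
  refine ⟨IsColimit.ofIsoColimit h' (BinaryCofan.ext
    ⟨e.hom.hom.hom, e.inv.hom.hom, ?_, ?_⟩ ?_ ?_)⟩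
  · exact congrArg (fun t => PXModHom.hom (CoconeMorphism.hom t)) e.hom_inv_id
  · exact congrArg (fun t => PXModHom.hom (CoconeMorphism.hom t)) e.inv_hom_id
  · exact congrArg PXModHom.hom (e.hom.w ⟨WalkingPair.left⟩)
  · exact congrArg PXModHom.hom (e.hom.w ⟨WalkingPair.right⟩)

end

end SemiAbelian

/-! ### Jointly strongly epimorphic pairs and the equivalence -/

namespace SemiAbelian

noncomputable section

variable {C : Type u} [Category.{v} C]

theorem JointlyStrongEpi.of_isColimit {X Y : C} {c : BinaryCofan X Y} (hc : IsColimit c) :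
    JointlyStrongEpi c.inl c.inr := by
  intro M N m _ x y z hx hy
  obtain ⟨d, h₁, h₂⟩ := BinaryCofan.IsColimit.desc' hc x y
  refine ⟨d, h₁, h₂, BinaryCofan.IsColimit.hom_ext hc ?_ ?_⟩
  · rw [reassoc_of% h₁, hx]
  · rw [reassoc_of% h₂, hy]

theorem JointlyStrongEpi.of_iso {X Y Z X' Y' Z' : C} {f : X ⟶ Z} {g : Y ⟶ Z}
    (h : JointlyStrongEpi f g) (a : X ≅ X') (b : Y ≅ Y') (c : Z ≅ Z') {f' : X' ⟶ Z'} {g' : Y' ⟶ Z'}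
    (hf : f ≫ c.hom = a.hom ≫ f') (hg : g ≫ c.hom = b.hom ≫ g') : JointlyStrongEpi f' g' := by
  intro M N m _ x y z hx hy
  obtain ⟨d, h₁, h₂, h₃⟩ := h m (a.hom ≫ x) (b.hom ≫ y) (c.hom ≫ z)
    (by rw [Category.assoc, hx, reassoc_of% hf]) (by rw [Category.assoc, hy, reassoc_of% hg])
  rw [← Iso.inv_comp_eq] at hf hg
  refine ⟨c.inv ≫ d, ?_, ?_, ?_⟩
  · simp [← hf, h₁]
  · simp [← hg, h₂]
  · simp [h₃]

theorem JointlyStrongEpi.isIso_of_factors {X Y Z M : C} {f : X ⟶ Z} {g : Y ⟶ Z}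
    (h : JointlyStrongEpi f g) (m : M ⟶ Z) [Mono m] (x : X ⟶ M) (y : Y ⟶ M) (hx : x ≫ m = f)
    (hy : y ≫ m = g) : IsIso m := by
  obtain ⟨d, -, -, hd⟩ := h m x y (𝟙 Z) (by rw [hx, Category.comp_id])
    (by rw [hy, Category.comp_id])
  exact ⟨d, by rw [← cancel_mono m, Category.assoc, hd, Category.id_comp, Category.comp_id], hd⟩

variable [HasZeroMorphisms C] [SemiAbelian C] {B : C}

theorem isRegularEpi_comp {X Y Z : C} {f : X ⟶ Y} {g : Y ⟶ Z} (hf : IsRegularEpi f)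
    (hg : IsRegularEpi g) : IsRegularEpi (f ≫ g) :=
  inferInstance

theorem isRegularEpi_of_comp {X Y Z : C} {f : X ⟶ Y} {g : Y ⟶ Z} (h : IsRegularEpi (f ≫ g)) :
    IsRegularEpi g :=
  have := strongEpi_of_strongEpi f g
  inferInstance

/-- A pair is jointly strongly epimorphic if and only if the induced morphism from the coproduct
is a regular epimorphism. -/
theorem jointlyStrongEpi_iff_isRegularEpi_desc {X Y Z : C} (f : X ⟶ Z) (g : Y ⟶ Z) :
    JointlyStrongEpi f g ↔ IsRegularEpi (coprod.desc f g) := by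
  constructor
  · intro h
    have : ExtremalEpi (coprod.desc f g) := .mk_of_hasEqualizers _ fun M p m hp _ =>
      h.isIso_of_factors m (coprod.inl ≫ p) (coprod.inr ≫ p)
        (by rw [Category.assoc, hp, coprod.inl_desc])
        (by rw [Category.assoc, hp, coprod.inr_desc])
    infer_instance
  · intro h M N m _ x y z hx hy
    have sq : CommSq (coprod.desc x y) (coprod.desc f g) m z :=
      ⟨by rw [coprod.desc_comp, coprod.desc_comp, hx, hy]⟩
    refine ⟨sq.lift, ?_, ?_, sq.fac_right⟩
    · simpa only [coprod.inl_desc, coprod.inl_desc_assoc] using coprod.inl ≫= sq.fac_left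
    · simpa only [coprod.inr_desc, coprod.inr_desc_assoc] using coprod.inr ≫= sq.fac_left

/-- If a jointly strongly epimorphic pair of morphisms of points factors through a morphism, then
that morphism is a regular epimorphism. -/
theorem JointlyStrongEpi.isRegularEpi_hom_of_factors {P Q R S : Pt B} {f : P ⟶ R} {g : Q ⟶ R}
    (h : JointlyStrongEpi f g) (t : S ⟶ R) (x : P ⟶ S) (y : Q ⟶ S) (hx : x ≫ t = f)
    (hy : y ≫ t = g) : IsRegularEpi t.hom := by
  -- The image of `t.hom` in `C` inherits a projection and a section, so it is a subobject of `R`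
  -- among points through which the pair factors; hence it is all of `R`.
  let F := Regular.strongEpiMonoFactorisation t.hom
  let I : Pt B := ⟨F.I, F.m ≫ R.proj, S.sec ≫ F.e, by
    rw [Category.assoc, F.fac_assoc, t.hom_proj, S.sec_proj]⟩
  let e : S ⟶ I := ⟨F.e, (F.fac_assoc _).trans t.hom_proj, rfl⟩
  let m : I ⟶ R := ⟨F.m, rfl, by rw [Category.assoc, F.fac, t.sec_hom]⟩
  have hem : e ≫ m = t := Pt.hom_ext _ _ F.fac
  have : Mono m := ⟨fun a b hab => Pt.hom_ext _ _
    ((cancel_mono F.m).1 (congrArg PtHom.hom hab))⟩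
  have : IsIso m := h.isIso_of_factors m (x ≫ e) (y ≫ e) (by rw [Category.assoc, hem, hx])
    (by rw [Category.assoc, hem, hy])
  have : IsIso F.m := ⟨(inv m).hom, congrArg PtHom.hom (IsIso.hom_inv_id m),
    congrArg PtHom.hom (IsIso.inv_hom_id m)⟩
  have : StrongEpi F.e := inferInstance
  have : StrongEpi t.hom := F.fac ▸ (inferInstance : StrongEpi (F.e ≫ F.m))
  infer_instance

/-- In an algebraically coherent category, the injections of a coproduct of internal actions are
jointly strongly epimorphic. -/
theorem AlgebraicallyCoherent.jointlyStrongEpi_of_isColimit (h : AlgebraicallyCoherent C)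
    {X Y Z : (flat B).Algebra} {i : X ⟶ Z} {j : Y ⟶ Z} (hc : IsColimit (BinaryCofan.mk i j)) :
    JointlyStrongEpi i.f j.f := by
  let E := (toAction B).asEquivalence
  have hij := JointlyStrongEpi.of_isColimit (mapIsColimitOfPreservesOfIsColimit E.inverse i j hc)
  let e (W : (flat B).Algebra) : ((flat B).forget.obj ((toAction B).obj (E.inverse.obj W))) ≅ W.A :=
    (flat B).forget.mapIso (E.counitIso.app W)
  -- The morphism underlying the action map of a morphism of points is its kernel map, so coherence
  -- applies to the corresponding points; the counit transports the result back.
  exact (h B _ _ _ _ _ hij).of_iso (e X) (e Y) (e Z)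
    (congrArg Monad.Algebra.Hom.f (E.counit_naturality i))
    (congrArg Monad.Algebra.Hom.f (E.counit_naturality j))

theorem AlgebraicallyCoherent.conditionCS (h : AlgebraicallyCoherent C) : ConditionCS C := by
  intro B X Y c ⟨hc⟩
  obtain ⟨hc'⟩ := nonempty_isColimit_binaryCofan_act hc
  exact (jointlyStrongEpi_iff_isRegularEpi_desc _ _).1 (h.jointlyStrongEpi_of_isColimit hc')

/-- An equivariant morphism, as a morphism of pre-crossed modules with zero boundary. -/
def PXMod.zeroMap {A A' : (flat B).Algebra} (f : A ⟶ A') : PXMod.zero A ⟶ PXMod.zero A' where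
  hom := f
  hom_δ := comp_zero

/-- Zero boundaries turn arbitrary actions into pre-crossed modules, so (CS) controls coproducts of
all actions. -/
theorem ConditionCS.algebraicallyCoherent (h : ConditionCS C) : AlgebraicallyCoherent C := by
  intro B P Q R f g hfg
  let K := toAction B
  let c : BinaryCofan (PXMod.zero (K.obj P)) (PXMod.zero (K.obj Q)) :=
    BinaryCofan.mk coprod.inl coprod.inr
  have hσ := h B _ _ c ⟨coprodIsCoprod _ _⟩
  let t : c.pt ⟶ PXMod.zero (K.obj R) :=
    coprod.desc (PXMod.zeroMap (K.map f)) (PXMod.zeroMap (K.map g))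
  let u : K.obj P ⟶ c.pt.act := c.inl.hom
  let v : K.obj Q ⟶ c.pt.act := c.inr.hom
  let w : c.pt.act ⟶ K.obj R := t.hom
  have hf' : c.inl ≫ t = PXMod.zeroMap (K.map f) := coprod.inl_desc _ _
  have hf : u ≫ w = K.map f := congrArg PXModHom.hom hf'
  have hg' : c.inr ≫ t = PXMod.zeroMap (K.map g) := coprod.inr_desc _ _
  have hg : v ≫ w = K.map g := congrArg PXModHom.hom hg'
  let i : K.obj (K.objPreimage c.pt.act) ≅ c.pt.act := K.objObjPreimageIso c.pt.act
  -- The map `w` out of the coproduct of actions, seen as a morphism of points; the pair `f`, `g`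
  -- factors through it.
  let t' : K.objPreimage c.pt.act ⟶ R := K.preimage (i.hom ≫ w)
  have : IsRegularEpi t'.hom := hfg.isRegularEpi_hom_of_factors t'
    (K.preimage (u ≫ i.inv)) (K.preimage (v ≫ i.inv))
    (K.map_injective (by rw [K.map_comp, K.map_preimage, K.map_preimage, Category.assoc,
      i.inv_hom_id_assoc, hf]))
    (K.map_injective (by rw [K.map_comp, K.map_preimage, K.map_preimage, Category.assoc,
      i.inv_hom_id_assoc, hg]))
  have : IsRegularEpi ((kerFunctor B).map t') := isRegularEpi_kerFunctor_map t'
  have ht : i.hom.f ≫ w.f = (kerFunctor B).map t' :=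
    congrArg Monad.Algebra.Hom.f (K.map_preimage (i.hom ≫ w)).symm
  have hw : IsRegularEpi w.f := isRegularEpi_of_comp (f := i.hom.f) (by rwa [ht])
  -- The copairing of the kernel maps is the comparison σ, a regular epimorphism by (CS), followed
  -- by the regular epimorphism `w.f`.
  have hd : coprod.desc u.f v.f ≫ w.f =
      coprod.desc ((kerFunctor B).map f) ((kerFunctor B).map g) := by
    rw [coprod.desc_comp]
    exact congrArg₂ coprod.desc (congrArg Monad.Algebra.Hom.f hf)
      (congrArg Monad.Algebra.Hom.f hg)
  rw [jointlyStrongEpi_iff_isRegularEpi_desc, ← hd]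
  exact isRegularEpi_comp hσ hw

end

end SemiAbelian

theorem mainTheorem4 (C : Type u) [Category.{v} C] [HasZeroMorphisms C] [SemiAbelian C] :
    (∀ B : C, HasBinaryCoproducts (SemiAbelian.PXMod B)) ∧
      (SemiAbelian.AlgebraicallyCoherent C ↔ SemiAbelian.ConditionCS C) :=
  ⟨fun _ => inferInstance, fun h => h.conditionCS, fun h => h.algebraicallyCoherent⟩
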